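/- For a point $x$ of a topological space $X$, let $\chi(x,X)$ be the least cardinality of a local base of open neighbourhoods at $x$, and let $\chi(X)=\max\{\omega,\ \sup_{x\in X}\chi(x,X)\}$ be the character of $X$. Call $X$ almost discretely Lindelöf if every discrete subset $D\subseteq X$ (that is, one whose subspace topology is discrete) is contained in some Lindelöf subspace of $X$. Theorem. Every almost discretely Lindelöf $T_3$ (i.e. regular and $T_1$) space $X$ satisfies $|X|\le 2^{\chi(X)}$. In particular, every first countable almost discretely Lindelöf $T_3$ space has cardinality at most the continuum, $2^{\omega}$. -/

import Mathlib

open Cardinal Topology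

universe u

/-- A topological space is almost discretely Lindelöf if each of its discrete subsets
(each set whose subspace topology is discrete) is contained in a Lindelöf subspace. -/
def AlmostDiscretelyLindelof (X : Type u) [TopologicalSpace X] : Prop :=
  ∀ D : Set X, IsDiscrete D → ∃ Y : Set X, D ⊆ Y ∧ IsLindelof Y

/-- A local base of `X` at the point `x`: a family of open sets containing `x` such that every
neighbourhood of `x` contains a member of the family. -/
def IsLocalBase {X : Type u} [TopologicalSpace X] (x : X) (B : Set (Set X)) : Prop :=
  (∀ U ∈ B, IsOpen U ∧ x ∈ U) ∧ ∀ N ∈ 𝓝 x, ∃ U ∈ B, U ⊆ N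

/-- The character `χ(x, X)` of a point: the least cardinality of a local base at `x`. -/
noncomputable def pointCharacter {X : Type u} [TopologicalSpace X] (x : X) : Cardinal.{u} :=
  sInf {c | ∃ B : Set (Set X), IsLocalBase x B ∧ #B = c}

/-- The character `χ(X)` of a space: the supremum of the characters of its points. As is usual for
cardinal functions, its value is always infinite. -/
noncomputable def character (X : Type u) [TopologicalSpace X] : Cardinal.{u} :=
  max ℵ₀ (⨆ x : X, pointCharacter x)

/-! Let `#k` be the character. Close a point off to a set `F` of size at most `2 ^ #k`, containing
closures of its nonempty subsets of size at most `#k` and points outside suitable unions of open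
sets. A point missed by `F` would yield a free sequence of length the successor of `#k` inside `F`,
which `not_free_sequence` excludes. Closing off needs closures of small sets to be intersections of
at most `2 ^ #k` open sets. This is proved twice: first in Lindelöf Hausdorff spaces, so that
discrete sets in `X` have size at most `2 ^ #k`; then in `X` itself, where regularity and a discrete
set reduce a closed set to that bound. -/

/-- Every point has a neighbourhood base indexed by `k`. -/
def HasNhdsBasesIndexedBy (k X : Type u) [TopologicalSpace X] : Prop :=
  ∀ x : X, ∃ U : k → Set X, (𝓝 x).HasBasis (fun _ ↦ True) U

/-- `Z` is an intersection of at most `2 ^ #k` open sets. -/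
def IsInterOfOpens (k : Type u) {X : Type u} [TopologicalSpace X] (Z : Set X) : Prop :=
  ∃ 𝒜 : Set (Set X), #𝒜 ≤ 2 ^ #k ∧ (∀ G ∈ 𝒜, IsOpen G ∧ Z ⊆ G) ∧ ∀ p ∉ Z, ∃ G ∈ 𝒜, p ∉ G

/-! ### Cardinal arithmetic and transfinite closing-off -/

section Cardinality

variable {k : Type u} [Infinite k]

theorem aleph0_le_two_power_mk : ℵ₀ ≤ (2 : Cardinal) ^ #k :=
  (aleph0_le_mk k).trans (cantor _).le

theorem power_mk_le_two_power_mk {K : Type u} (hK : #K ≤ #k) {c : Cardinal.{u}}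
    (hc : c ≤ 2 ^ #k) : c ^ #K ≤ 2 ^ #k := by
  calc c ^ #K ≤ (2 ^ #k) ^ #K := power_le_power_right hc
    _ = 2 ^ (#k * #K) := (power_mul).symm
    _ ≤ 2 ^ #k := power_le_power_left two_ne_zero
      ((mul_le_mul_right hK _).trans (mul_eq_self (aleph0_le_mk k)).le)

theorem mk_fun_le_two_power_mk {K A : Type u} (hK : #K ≤ #k) (hA : #A ≤ 2 ^ #k) :
    #(K → A) ≤ 2 ^ #k := by
  rw [← power_def]
  exact power_mk_le_two_power_mk hK hA

theorem mk_iUnion_le_of_le {I X : Type u} {c : Cardinal.{u}} (hc : ℵ₀ ≤ c) (hI : #I ≤ c)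
    {f : I → Set X} (hf : ∀ i, #(f i) ≤ c) : #(⋃ i, f i) ≤ c :=
  (mk_iUnion_le f).trans <| (mul_le_mul' hI (ciSup_le' hf)).trans (mul_eq_self hc).le

theorem mk_union_le_of_le {X : Type u} {c : Cardinal.{u}} (hc : ℵ₀ ≤ c) {s t : Set X}
    (hs : #s ≤ c) (ht : #t ≤ c) : #(s ∪ t : Set X) ≤ c :=
  (mk_union_le s t).trans <| (add_le_add hs ht).trans (add_eq_self hc).le

theorem exists_range_eq_of_mk_le {K X : Type u} {S : Set X} (hS : S.Nonempty) (h : #S ≤ #K) :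
    ∃ e : K → X, Set.range e = S := by
  have := hS.to_subtype
  obtain ⟨f⟩ := Cardinal.le_def _ _ |>.1 h
  refine ⟨fun i ↦ (Function.invFun f i : S), ?_⟩
  rw [Set.range_comp' Subtype.val, (Function.invFun_surjective f.injective).range_eq]
  simp

variable (k) in
/-- The properties of the successor cardinal of `#k` used in recursive constructions. -/
theorem exists_wellOrder_succ : ∃ (ι : Type u) (_ : LinearOrder ι) (_ : WellFoundedLT ι),
    #ι ≤ 2 ^ #k ∧ (∀ i : ι, #(Set.Iio i) ≤ #k) ∧
      ∀ (J : Type u) (f : J → ι), #J ≤ #k → ∃ i, ∀ j, f j < i := by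
  refine ⟨(Order.succ #k).ord.ToType, inferInstance, inferInstance, ?_, fun i ↦ ?_,
    fun J f hJ ↦ ?_⟩
  · rw [mk_ord_toType]
    exact Order.succ_le_of_lt (cantor _)
  · have := mk_Iio_lt i (by simp)
    rwa [mk_ord_toType, Order.lt_succ_iff] at this
  · by_contra! h
    have hcof : IsCofinal (Set.range f) := fun i ↦ by
      obtain ⟨j, hj⟩ := h i
      exact ⟨f j, ⟨j, rfl⟩, hj⟩
    have h1 := (Order.cof_le hcof).trans (mk_range_le.trans hJ)
    rw [Ordinal.cof_toType, (isRegular_succ (aleph0_le_mk k)).cof_ord] at h1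
    exact (Order.lt_succ #k).not_ge h1

/-- Transfinite recursion along a well-order. -/
theorem exists_forall_eq_step {ι : Type u} [LinearOrder ι] [WellFoundedLT ι] {X : Type*}
    (step : ∀ i : ι, (Set.Iio i → X) → X) : ∃ x : ι → X, ∀ i, x i = step i (fun j ↦ x j) :=
  ⟨wellFounded_lt.fix fun i f ↦ step i fun j ↦ f j j.2, fun i ↦ wellFounded_lt.fix_eq _ i⟩

/-- A set closed under a set-valued operation of arity `K`. -/
theorem exists_mem_closed_under {K X : Type u} (hK : #K ≤ #k) (Φ : (K → X) → Set X)
    (hΦ : ∀ s, #(Φ s) ≤ 2 ^ #k) (a : X) :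
    ∃ F : Set X, a ∈ F ∧ #F ≤ 2 ^ #k ∧ ∀ s : K → X, (∀ i, s i ∈ F) → Φ s ⊆ F := by
  obtain ⟨ι, _, _, hι, hIio, hbdd⟩ := exists_wellOrder_succ k
  have hω := aleph0_le_two_power_mk (k := k)
  let B : ∀ i : ι, (Set.Iio i → Set X) → Set X := fun i A ↦ {a} ∪ ⋃ j, A j
  obtain ⟨A, hA⟩ := exists_forall_eq_step (ι := ι) (X := Set X) fun i A ↦
    B i A ∪ ⋃ s : K → B i A, Φ fun x ↦ s x
  have hcard : ∀ i, #(A i) ≤ 2 ^ #k := fun i ↦ by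
    induction i using WellFoundedLT.induction with
    | _ i ih =>
      have hB : #(B i fun j ↦ A j) ≤ 2 ^ #k :=
        mk_union_le_of_le hω (by simpa using one_le_aleph0.trans hω)
          (mk_iUnion_le_of_le hω ((hIio i).trans (cantor _).le) fun j ↦ ih j j.2)
      rw [hA]
      exact mk_union_le_of_le hω hB
        (mk_iUnion_le_of_le hω (mk_fun_le_two_power_mk hK hB) fun s ↦ hΦ _)
  refine ⟨⋃ i, A i, ?_, mk_iUnion_le_of_le hω hι hcard, fun s hs ↦ ?_⟩
  · obtain ⟨i, -⟩ := hbdd PEmpty PEmpty.elim (by simp)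
    refine Set.mem_iUnion.2 ⟨i, ?_⟩
    rw [hA]
    exact .inl (.inl rfl)
  · choose i hi using fun x ↦ Set.mem_iUnion.1 (hs x)
    obtain ⟨m, hm⟩ := hbdd K i hK
    refine Set.subset_iUnion_of_subset m ?_
    rw [hA]
    refine Set.subset_union_of_subset_right ?_ _
    exact Set.subset_iUnion (fun s : K → B m fun j ↦ A j ↦ Φ fun x ↦ s x)
      fun x ↦ ⟨s x, .inr (Set.mem_iUnion.2 ⟨⟨i x, hm x⟩, hi x⟩)⟩

end Cardinality

theorem HasNhdsBasesIndexedBy.subtype {k X : Type u} [TopologicalSpace X]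
    (hU : HasNhdsBasesIndexedBy k X) (Y : Set X) :
    HasNhdsBasesIndexedBy k Y := fun y ↦ by
  obtain ⟨U, hU⟩ := hU y
  refine ⟨fun i ↦ Subtype.val ⁻¹' U i, ?_⟩
  rw [nhds_subtype_eq_comap]
  exact hU.comap Subtype.val

/-! ### Closures and free sequences -/

section Topology

variable {k X : Type u} [Infinite k] [TopologicalSpace X]

/-- Each point of the closure is the limit of a net in `A` indexed by the finite subsets of `k`.
Limits are unique, so it suffices to count such nets. -/
theorem mk_closure_le_two_power_mk [T2Space X] (hU : HasNhdsBasesIndexedBy k X) {A : Set X}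
    (hA : #A ≤ 2 ^ #k) : #(closure A) ≤ 2 ^ #k := by
  choose U hU using hU
  have key : ∀ x : closure A, ∃ s : Finset k → A,
      Filter.Tendsto (fun e ↦ (s e : X)) Filter.atTop (𝓝 (x : X)) := fun x ↦ by
    have : ∀ e : Finset k, ∃ y : A, ∀ ξ ∈ e, (y : X) ∈ U x ξ := fun e ↦ by
      have hmem : (⋂ ξ ∈ e, U x ξ) ∈ 𝓝 (x : X) :=
        (Filter.biInter_finset_mem e).2 fun ξ _ ↦ (hU x).mem_of_mem trivial
      obtain ⟨y, hy, hyA⟩ := mem_closure_iff_nhds.1 x.2 _ hmem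
      exact ⟨⟨y, hyA⟩, by simpa using hy⟩
    choose s hs using this
    refine ⟨s, (hU x).tendsto_right_iff.2 fun ξ _ ↦ ?_⟩
    filter_upwards [Filter.eventually_ge_atTop {ξ}] with e he
    exact hs e ξ (he (Finset.mem_singleton_self ξ))
  choose s hs using key
  have hinj : Function.Injective s := fun x y hxy ↦
    Subtype.ext (tendsto_nhds_unique (hs x) (hxy ▸ hs y))
  exact (mk_le_of_injective hinj).trans
    (mk_fun_le_two_power_mk (mk_finset_of_infinite k).le hA)

/-- In an almost discretely Lindelöf space whose points have bases indexed by `k`, there is no free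
sequence of length the successor of `#k`. -/
theorem AlmostDiscretelyLindelof.not_free_sequence (hX : AlmostDiscretelyLindelof X)
    (hU : HasNhdsBasesIndexedBy k X) {ι : Type u} [LinearOrder ι] [WellFoundedLT ι]
    (hbdd : ∀ (J : Type u) (f : J → ι), #J ≤ #k → ∃ i, ∀ j, f j < i)
    {x : ι → X} {G : ι → Set X} (hG : ∀ i, IsOpen (G i))
    (hsub : ∀ i, closure (x '' Set.Iio i) ⊆ G i) (hx : ∀ i, ∀ j ≤ i, x i ∉ G j) : False := by
  have hωk := aleph0_le_mk k
  have hlt : ∀ i, ∃ j, i < j := fun i ↦ by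
    obtain ⟨j, hj⟩ := hbdd PUnit (fun _ ↦ i) (by simpa using one_le_aleph0.trans hωk)
    exact ⟨j, hj ⟨⟩⟩
  have hD : IsDiscrete (Set.range x) := by
    rw [isDiscrete_iff_forall_mem_exists_isOpen]
    rintro _ ⟨i, rfl⟩
    obtain ⟨j, hj, hmin⟩ := wellFounded_lt.has_min (Set.Ioi i) (hlt i)
    -- Here `j` is the successor of `i`: terms from `j` on avoid `G j`, and terms before `i` lie in
    -- the removed closure.
    refine ⟨G j ∩ (closure (x '' Set.Iio i))ᶜ, (hG j).inter isClosed_closure.isOpen_compl,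
      Set.Subset.antisymm ?_ (Set.singleton_subset_iff.2
        ⟨⟨hsub j (subset_closure ⟨i, hj, rfl⟩), fun h ↦ hx i i le_rfl (hsub i h)⟩, i, rfl⟩)⟩
    rintro _ ⟨⟨h1, h2⟩, m, rfl⟩
    rcases lt_trichotomy m i with h | rfl | h
    · exact (h2 (subset_closure (Set.mem_image_of_mem x h))).elim
    · rfl
    · exact absurd h1 (hx m j (not_lt.1 (hmin m h)))
  obtain ⟨Y, hDY, hY⟩ := hX _ hD
  -- By the bound on the character, a limit of the whole sequence is already a limit of an initial
  -- segment, hence lies in some `G m`, which misses the tail from `m`.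
  have hcov : ∀ y, ∃ i, y ∉ closure (x '' Set.Ici i) := fun y ↦ by
    by_cases hy : y ∈ closure (Set.range x)
    · obtain ⟨U, hU⟩ := hU y
      have : ∀ ξ, ∃ i, x i ∈ U ξ := fun ξ ↦ by
        obtain ⟨_, hz, i, rfl⟩ := mem_closure_iff_nhds.1 hy _ (hU.mem_of_mem (i := ξ) trivial)
        exact ⟨i, hz⟩
      choose i hi using this
      obtain ⟨m, hm⟩ := hbdd k i le_rfl
      have hyG : y ∈ G m := hsub m <| (mem_closure_iff_nhds_basis hU).2 fun ξ _ ↦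
        ⟨x (i ξ), ⟨i ξ, hm ξ, rfl⟩, hi ξ⟩
      refine ⟨m, fun h ↦ ?_⟩
      obtain ⟨_, hz, j, hj, rfl⟩ := mem_closure_iff.1 h _ (hG m) hyG
      exact hx j m hj hz
    · obtain ⟨i, -⟩ := hbdd PEmpty PEmpty.elim (by simp)
      exact ⟨i, fun h ↦ hy (closure_mono (Set.image_subset_range _ _) h)⟩
  obtain ⟨t, ht, htY⟩ := hY.elim_countable_subcover (fun i ↦ (closure (x '' Set.Ici i))ᶜ)
    (fun i ↦ isClosed_closure.isOpen_compl) fun y _ ↦ by simpa using hcov y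
  obtain ⟨m, hm⟩ := hbdd t Subtype.val ((le_aleph0_iff_set_countable.2 ht).trans hωk)
  obtain ⟨i, hi, hxi⟩ := Set.mem_iUnion₂.1 (htY (hDY ⟨m, rfl⟩))
  exact hxi (subset_closure ⟨m, (hm ⟨i, hi⟩).le, rfl⟩)

end Topology

/-! ### Closing off, pseudocharacter of closed sets, discrete sets -/

section Bounds

variable {k X : Type u} [Infinite k] [TopologicalSpace X]

theorem AlmostDiscretelyLindelof.mk_le_two_power_mk [T2Space X] (hX : AlmostDiscretelyLindelof X)
    (hU : HasNhdsBasesIndexedBy k X)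
    (hψ : ∀ S : Set X, #S ≤ #k → IsInterOfOpens k (closure S)) : #X ≤ 2 ^ #k := by
  have hω := aleph0_le_two_power_mk (k := k)
  have hωk := aleph0_le_mk k
  rcases isEmpty_or_nonempty X with hE | hne
  · simp
  obtain ⟨a⟩ := id hne
  have hψ' : ∀ S : Set X, #S ≤ #k → ∃ g : Set k → Set X,
      (∀ l, IsOpen (g l) ∧ closure S ⊆ g l) ∧ ∀ p ∉ closure S, ∃ l, p ∉ g l := fun S hS ↦ by
    obtain ⟨𝒜, h𝒜, hopen, hsep⟩ := hψ S hS
    -- Adding `Set.univ` makes the family nonempty, so that it can be enumerated by `Set k`.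
    obtain ⟨g, hg⟩ := exists_range_eq_of_mk_le (K := Set k) (Set.insert_nonempty Set.univ 𝒜)
      (mk_insert_le.trans (by
        rw [mk_set]
        exact (add_le_add h𝒜 (one_le_aleph0.trans hω)).trans (add_eq_self hω).le))
    refine ⟨g, fun l ↦ ?_, fun p hp ↦ ?_⟩
    · rcases hg ▸ Set.mem_range_self l with h | h
      · simp [h]
      · exact hopen _ h
    · obtain ⟨G, hG, hpG⟩ := hsep p hp
      obtain ⟨l, rfl⟩ : G ∈ Set.range g := hg ▸ .inr hG
      exact ⟨l, hpG⟩
  choose! g hg hgsep using hψ'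
  have hkk : #(k × k) ≤ #k := by simp
  let pick : Set X → X := fun T ↦ Classical.epsilon fun x ↦ x ∉ T
  -- The rows of the matrix `s` encode `#k` small sets at once; `c` chooses one open set around the
  -- closure of each.
  let Φ : (k × k → X) → Set X := fun s ↦ closure (Set.range s) ∪
    Set.range fun c : k → Set k ↦ pick (⋃ i, g (Set.range fun j ↦ s (i, j)) (c i))
  obtain ⟨F, haF, hF, hclosed⟩ := exists_mem_closed_under hkk Φ (fun s ↦
    mk_union_le_of_le hω
      (mk_closure_le_two_power_mk hU (mk_range_le.trans (hkk.trans (cantor _).le)))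
      (mk_range_le.trans (mk_fun_le_two_power_mk le_rfl mk_set.le))) a
  suffices hFuniv : ∀ p, p ∈ F by
    rw [← mk_univ, ← Set.eq_univ_of_forall hFuniv]
    exact hF
  by_contra! hp
  obtain ⟨p, hp⟩ := hp
  have hcl : ∀ S ⊆ F, S.Nonempty → #S ≤ #k → closure S ⊆ F := fun S hSF hne hS ↦ by
    obtain ⟨e, rfl⟩ := exists_range_eq_of_mk_le hne hS
    have h1 := hclosed (fun ij ↦ e ij.2) fun ij ↦ hSF ⟨ij.2, rfl⟩
    refine (closure_mono ?_).trans (Set.subset_union_left.trans h1)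
    rintro _ ⟨i, rfl⟩
    exact ⟨(i, i), rfl⟩
  have hl : ∀ S : Set X, ∃ l, S ⊆ F → S.Nonempty → #S ≤ #k → p ∉ g S l := fun S ↦ by
    by_cases h : S ⊆ F ∧ S.Nonempty ∧ #S ≤ #k
    · obtain ⟨l, hl⟩ := hgsep S h.2.2 p fun hpS ↦ hp (hcl S h.1 h.2.1 h.2.2 hpS)
      exact ⟨l, fun _ _ _ ↦ hl⟩
    · exact ⟨∅, fun h1 h2 h3 ↦ absurd ⟨h1, h2, h3⟩ h⟩
  choose l hl using hl
  have hpick : ∀ (J : Type u) (S : J → Set X), Nonempty J → #J ≤ #k →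
      (∀ j, S j ⊆ F ∧ (S j).Nonempty ∧ #(S j) ≤ #k) →
      ∃ x ∈ F, ∀ j, x ∉ g (S j) (l (S j)) := fun J S hJ hJk hS ↦ by
    obtain ⟨r, hr⟩ := exists_range_eq_of_mk_le (K := k) (Set.univ_nonempty (α := J))
      (by simpa using hJk)
    choose e he using fun j ↦ exists_range_eq_of_mk_le (hS j).2.1 (hS j).2.2
    have hsub := hclosed (fun ij ↦ e (r ij.1) ij.2) fun ij ↦
      (hS (r ij.1)).1 (he (r ij.1) ▸ Set.mem_range_self _)
    have hmem := hsub (.inr ⟨fun i ↦ l (S (r i)), rfl⟩)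
    simp only [he] at hmem
    refine ⟨_, hmem, fun j hj ↦ ?_⟩
    have hex : ∃ x, x ∉ ⋃ i, g (S (r i)) (l (S (r i))) :=
      ⟨p, fun h ↦ by
        obtain ⟨i, hi⟩ := Set.mem_iUnion.1 h
        exact hl _ (hS _).1 (hS _).2.1 (hS _).2.2 hi⟩
    obtain ⟨i, rfl⟩ : j ∈ Set.range r := hr ▸ trivial
    exact Classical.epsilon_spec hex (Set.mem_iUnion.2 ⟨i, by exact hj⟩)
  obtain ⟨ι, _, _, -, hIio, hbdd⟩ := exists_wellOrder_succ k
  -- Inserting `a` keeps the set nonempty at the first stage of the recursion.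
  let G : Set X → Set X := fun S ↦ g (insert a S) (l (insert a S))
  obtain ⟨x, hx⟩ := exists_forall_eq_step (ι := ι) (X := X) fun i f ↦
    Classical.epsilon fun y ↦ y ∈ F ∧ ∀ j ≤ i, y ∉ G {z | ∃ m : Set.Iio i, m < j ∧ f m = z}
  have hIic : ∀ i : ι, #(Set.Iic i) ≤ #k := fun i ↦ by
    obtain ⟨j, hj⟩ := hbdd PUnit (fun _ ↦ i) (by simpa using one_le_aleph0.trans hωk)
    exact (mk_le_mk_of_subset (Set.Iic_subset_Iio.2 (hj ⟨⟩))).trans (hIio j)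
  have hsmall : ∀ i, #(insert a (x '' Set.Iio i) : Set X) ≤ #k := fun i ↦
    mk_insert_le.trans <| (add_le_add (mk_image_le.trans (hIio i))
      (one_le_aleph0.trans hωk)).trans (add_eq_self hωk).le
  have himage : ∀ i, ∀ j ≤ i, {z | ∃ m : Set.Iio i, (m : ι) < j ∧ x m = z} = x '' Set.Iio j :=
    fun i j hji ↦ Set.ext fun z ↦
      ⟨fun ⟨m, hm, hz⟩ ↦ ⟨m, hm, hz⟩, fun ⟨m, hm, hz⟩ ↦ ⟨⟨m, hm.trans_le hji⟩, hm, hz⟩⟩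
  have main : ∀ i, x i ∈ F ∧ ∀ j ≤ i, x i ∉ G (x '' Set.Iio j) := fun i ↦ by
    induction i using WellFoundedLT.induction with
    | _ i ih =>
      obtain ⟨y, hyF, hy⟩ := hpick (Set.Iic i) (fun j ↦ insert a (x '' Set.Iio (j : ι)))
        ⟨⟨i, le_rfl⟩⟩ (hIic i) fun j ↦ ⟨Set.insert_subset haF (by
          rintro _ ⟨m, hm, rfl⟩
          exact (ih m (hm.trans_le j.2)).1), Set.insert_nonempty _ _, hsmall j⟩
      have hex : ∃ y, y ∈ F ∧
          ∀ j ≤ i, y ∉ G {z | ∃ m : Set.Iio i, (m : ι) < j ∧ x m = z} :=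
        ⟨y, hyF, fun j hj ↦ by
          rw [himage i j hj]
          exact hy ⟨j, hj⟩⟩
      have h := Classical.epsilon_spec hex
      rw [← hx i] at h
      exact ⟨h.1, fun j hj ↦ by simpa only [himage i j hj] using h.2 j hj⟩
  exact hX.not_free_sequence hU hbdd (x := x) (G := fun i ↦ G (x '' Set.Iio i))
    (fun i ↦ (hg _ (hsmall i) _).1)
    (fun i ↦ (closure_mono (Set.subset_insert _ _)).trans (hg _ (hsmall i) _).2)
    fun i ↦ (main i).2

/-- Given a point outside `Z`, countably many basic neighbourhoods missing it cover `Z`, and there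
are at most `2 ^ #k` countable unions of interiors of basic sets. -/
theorem isInterOfOpens_of_isLindelof [T2Space X] (hU : HasNhdsBasesIndexedBy k X) {Z : Set X}
    (hZ : IsLindelof Z) (hcard : #Z ≤ 2 ^ #k) : IsInterOfOpens k Z := by
  have hω := aleph0_le_two_power_mk (k := k)
  choose U hU using hU
  let f : (ULift.{u} ℕ → Z × k) → Set X := fun s ↦ ⋃ n, interior (U (s n).1 (s n).2)
  refine ⟨{G ∈ insert ∅ (Set.range f) | Z ⊆ G}, ?_, ?_, fun p hp ↦ ?_⟩
  · refine (mk_le_mk_of_subset (Set.sep_subset _ _)).trans <| mk_insert_le.trans <|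
      (add_le_add (mk_range_le.trans (mk_fun_le_two_power_mk ?_ ?_))
        (one_le_aleph0.trans hω)).trans (add_eq_self hω).le
    · simp
    · rw [mk_prod, lift_id, lift_id]
      exact (mul_le_mul' hcard (cantor _).le).trans (mul_eq_self hω).le
  · rintro G ⟨rfl | ⟨s, rfl⟩, hG⟩
    · exact ⟨isOpen_empty, hG⟩
    · exact ⟨isOpen_iUnion fun n ↦ isOpen_interior, hG⟩
  · rcases Z.eq_empty_or_nonempty with rfl | hne
    · exact ⟨∅, ⟨.inl rfl, le_rfl⟩, id⟩
    have : ∀ z : Z, ∃ ξ, p ∉ U z ξ := fun z ↦ by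
      obtain ⟨ξ, -, hξ⟩ := (hU z).mem_iff.1
        (isOpen_compl_singleton.mem_nhds fun h : (z : X) = p ↦ hp (h ▸ z.2))
      exact ⟨ξ, fun h ↦ hξ h rfl⟩
    choose ξ hξ using this
    obtain ⟨t, ht, htZ⟩ := hZ.elim_countable_subcover (fun z : Z ↦ interior (U z (ξ z)))
      (fun z ↦ isOpen_interior) fun z hz ↦ Set.mem_iUnion.2
        ⟨⟨z, hz⟩, mem_interior_iff_mem_nhds.2 ((hU z).mem_of_mem trivial)⟩
    have htne : t.Nonempty := by
      obtain ⟨z, hz⟩ := hne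
      obtain ⟨i, hi, -⟩ := Set.mem_iUnion₂.1 (htZ hz)
      exact ⟨i, hi⟩
    obtain ⟨e, rfl⟩ := ht.exists_eq_range htne
    refine ⟨f fun n ↦ (e n.down, ξ (e n.down)), ⟨.inr ⟨_, rfl⟩, fun z hz ↦ ?_⟩, fun h ↦ ?_⟩
    · obtain ⟨_, ⟨n, rfl⟩, hn⟩ := Set.mem_iUnion₂.1 (htZ hz)
      exact Set.mem_iUnion.2 ⟨⟨n⟩, hn⟩
    · obtain ⟨n, hn⟩ := Set.mem_iUnion.1 h
      exact hξ _ (interior_subset hn)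

/-- A Lindelöf Hausdorff space has cardinality at most `2 ^ χ`. -/
theorem mk_le_two_power_mk_of_lindelofSpace [T2Space X] [LindelofSpace X]
    (hU : HasNhdsBasesIndexedBy k X) : #X ≤ 2 ^ #k :=
  AlmostDiscretelyLindelof.mk_le_two_power_mk
    (fun _ _ ↦ ⟨Set.univ, Set.subset_univ _, isLindelof_univ⟩) hU fun _ hS ↦
      isInterOfOpens_of_isLindelof hU isClosed_closure.isLindelof
        (mk_closure_le_two_power_mk hU (hS.trans (cantor _).le))

theorem AlmostDiscretelyLindelof.mk_isDiscrete_le [T2Space X] (hX : AlmostDiscretelyLindelof X)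
    (hU : HasNhdsBasesIndexedBy k X) {D : Set X} (hD : IsDiscrete D) : #D ≤ 2 ^ #k := by
  obtain ⟨Y, hDY, hY⟩ := hX D hD
  have := isLindelof_iff_lindelofSpace.1 hY
  exact (mk_le_mk_of_subset hDY).trans (mk_le_two_power_mk_of_lindelofSpace (hU.subtype Y))

/-- Every family of neighbourhoods of the points of `P` has a subfamily, indexed by a discrete
set `D`, that together with the closure of `D` covers `P`. -/
theorem exists_isDiscrete_subset_closure_union (P : Set X) {W : X → Set X}
    (hW : ∀ p ∈ P, IsOpen (W p) ∧ p ∈ W p) :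
    ∃ D ⊆ P, IsDiscrete D ∧ P ⊆ closure D ∪ ⋃ p ∈ D, W p := by
  obtain ⟨_, _⟩ := exists_wellFoundedLT X
  obtain ⟨d, hd⟩ := exists_forall_eq_step (ι := X) (X := Prop) fun p f ↦
    p ∈ P ∧ p ∉ closure {q | ∃ h : q < p, f ⟨q, h⟩} ∧ ∀ q : Set.Iio p, f q → p ∉ W q
  have hd' : ∀ p, d p ↔ p ∈ P ∧ p ∉ closure {q | q < p ∧ d q} ∧ ∀ q < p, d q → p ∉ W q :=
    fun p ↦ by
      conv_lhs => rw [hd]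
      simp
  have hDP : {p | d p} ⊆ P := fun p hp ↦ ((hd' p).1 hp).1
  refine ⟨{p | d p}, hDP, ?_, fun p hp ↦ ?_⟩
  · rw [isDiscrete_iff_forall_mem_exists_isOpen]
    intro p hp
    -- Later members of `D` avoid `W p`; earlier ones lie in the removed closure.
    refine ⟨W p ∩ (closure {q | q < p ∧ d q})ᶜ,
      (hW p (hDP hp)).1.inter isClosed_closure.isOpen_compl, Set.Subset.antisymm ?_
        (Set.singleton_subset_iff.2 ⟨⟨(hW p (hDP hp)).2, ((hd' p).1 hp).2.1⟩, hp⟩)⟩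
    rintro q ⟨⟨h1, h2⟩, hq⟩
    rcases lt_trichotomy q p with h | rfl | h
    · exact (h2 (subset_closure ⟨h, hq⟩)).elim
    · rfl
    · exact absurd h1 (((hd' q).1 hq).2.2 p h hp)
  · by_contra h
    simp only [Set.mem_union, Set.mem_iUnion, not_or, not_exists] at h
    exact h.2 p ((hd' p).2 ⟨hp, fun h' ↦ h.1 (closure_mono (fun q hq ↦ hq.2) h'),
      fun q _ hq ↦ h.2 q hq⟩) (hW p hp).2

/-- Regularity gives each point off `Z` a neighbourhood `W p` whose closure misses `Z`. A discrete
`D` covers the complement by `closure D` and the sets `W p`; remove points one by one in the first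
part, and closures of the `W p` in the second. -/
theorem AlmostDiscretelyLindelof.isInterOfOpens [T3Space X] (hX : AlmostDiscretelyLindelof X)
    (hU : HasNhdsBasesIndexedBy k X) {Z : Set X} (hZ : IsClosed Z) : IsInterOfOpens k Z := by
  have hω := aleph0_le_two_power_mk (k := k)
  have : ∀ p, ∃ W, p ∈ Zᶜ → (IsOpen W ∧ p ∈ W) ∧ Disjoint (closure W) Z := fun p ↦ by
    by_cases hp : p ∈ Zᶜ
    · obtain ⟨C, hC, hCcl, hCZ⟩ := exists_mem_nhds_isClosed_subset (hZ.isOpen_compl.mem_nhds hp)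
      exact ⟨interior C, fun _ ↦ ⟨⟨isOpen_interior, mem_interior_iff_mem_nhds.2 hC⟩,
        Set.disjoint_left.2 fun q hq ↦ hCZ (closure_minimal interior_subset hCcl hq)⟩⟩
    · exact ⟨∅, fun h ↦ absurd h hp⟩
  choose W hW using this
  obtain ⟨D, hDZ, hD, hcov⟩ := exists_isDiscrete_subset_closure_union Zᶜ fun p hp ↦ (hW p hp).1
  have hcard := hX.mk_isDiscrete_le hU hD
  refine ⟨(fun z ↦ {z}ᶜ) '' (closure D \ Z) ∪ (fun p ↦ (closure (W p))ᶜ) '' D,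
    mk_union_le_of_le hω (mk_image_le.trans ((mk_le_mk_of_subset Set.sdiff_subset).trans
      (mk_closure_le_two_power_mk hU hcard))) (mk_image_le.trans hcard), ?_, fun p hp ↦ ?_⟩
  · rintro _ (⟨z, hz, rfl⟩ | ⟨p, hp, rfl⟩)
    · exact ⟨isOpen_compl_singleton, Set.subset_compl_singleton_iff.2 hz.2⟩
    · exact ⟨isClosed_closure.isOpen_compl,
        Set.subset_compl_iff_disjoint_left.2 (hW p (hDZ hp)).2⟩
  · rcases hcov hp with h | h
    · exact ⟨_, .inl ⟨p, ⟨h, hp⟩, rfl⟩, fun h ↦ h rfl⟩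
    · obtain ⟨q, hq, hpq⟩ := Set.mem_iUnion₂.1 h
      exact ⟨_, .inr ⟨q, hq, rfl⟩, fun h ↦ h (subset_closure hpq)⟩

end Bounds

/-! ### From the character to indexed bases, and the theorem -/

theorem pointCharacter_mem {X : Type u} [TopologicalSpace X] (x : X) :
    ∃ B : Set (Set X), IsLocalBase x B ∧ #B = pointCharacter x :=
  csInf_mem (s := {c | ∃ B : Set (Set X), IsLocalBase x B ∧ #B = c})
    ⟨_, {U | IsOpen U ∧ x ∈ U}, ⟨fun _ ↦ id, fun _ hN ↦ by
      obtain ⟨U, hUN, hU⟩ := mem_nhds_iff.1 hN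
      exact ⟨U, hU, hUN⟩⟩, rfl⟩

theorem hasNhdsBasesIndexedBy_of_character_le {k X : Type u} [TopologicalSpace X]
    (hk : character X ≤ #k) : HasNhdsBasesIndexedBy k X := fun x ↦ by
  obtain ⟨B, ⟨hB, hBN⟩, hcard⟩ := pointCharacter_mem x
  have hne : B.Nonempty := by
    obtain ⟨U, hU, -⟩ := hBN _ Filter.univ_mem
    exact ⟨U, hU⟩
  obtain ⟨e, rfl⟩ := exists_range_eq_of_mk_le (K := k) hne
    (hcard.trans_le ((le_ciSup (bddAbove_of_small) x).trans ((le_max_right _ _).trans hk)))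
  refine ⟨e, Filter.hasBasis_iff.2 fun N ↦ ⟨fun hN ↦ ?_, fun ⟨i, _, hi⟩ ↦ ?_⟩⟩
  · obtain ⟨_, ⟨i, rfl⟩, hi⟩ := hBN N hN
    exact ⟨i, trivial, hi⟩
  · exact Filter.mem_of_superset ((hB _ ⟨i, rfl⟩).1.mem_nhds (hB _ ⟨i, rfl⟩).2) hi

theorem character_le_aleph0 (X : Type u) [TopologicalSpace X] [FirstCountableTopology X] :
    character X ≤ ℵ₀ := by
  refine max_le le_rfl (ciSup_le' fun x ↦ ?_)
  obtain ⟨U, hU⟩ := (𝓝 x).exists_antitone_basis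
  refine (csInf_le' (show _ ∈ {c | ∃ B : Set (Set X), IsLocalBase x B ∧ #B = c} from
    ⟨Set.range fun n ↦ interior (U n), ⟨?_, fun N hN ↦ ?_⟩, rfl⟩)).trans
    (le_aleph0_iff_set_countable.2 (Set.countable_range _))
  · rintro _ ⟨n, rfl⟩
    exact ⟨isOpen_interior, mem_interior_iff_mem_nhds.2 (hU.1.mem_of_mem trivial)⟩
  · obtain ⟨n, -, hn⟩ := hU.1.mem_iff.1 hN
    exact ⟨_, ⟨n, rfl⟩, interior_subset.trans hn⟩

theorem theorem2 (X : Type u) [TopologicalSpace X] [T3Space X]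
    (hX : AlmostDiscretelyLindelof X) :
    #X ≤ 2 ^ character X ∧ (FirstCountableTopology X → #X ≤ 𝔠) := by
  have main : #X ≤ 2 ^ character X := by
    have hk : #(character X).out = character X := mk_out _
    have : Infinite (character X).out := infinite_iff.2 ((le_max_left _ _).trans_eq hk.symm)
    have hU : HasNhdsBasesIndexedBy (character X).out X :=
      hasNhdsBasesIndexedBy_of_character_le hk.ge
    have h := hX.mk_le_two_power_mk hU fun S _ ↦ hX.isInterOfOpens hU isClosed_closure
    rwa [hk] at h
  exact ⟨main, fun _ ↦ main.trans <| (power_le_power_left two_ne_zero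
    (character_le_aleph0 X)).trans_eq two_power_aleph0⟩
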